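/- **Conventions.** $\mathbb B^k_r$ is the closed Euclidean ball and $\mathbb S^{k-1}_r$ the Euclidean sphere of radius $r$ around $0$ in $\mathbb R^k$. A map on an arbitrary subset of a Euclidean space is called smooth if near each point it extends to a $C^\infty$ map on an open set, and diffeomorphisms between such subsets are understood accordingly. For a smooth map $p:\mathbb R^m\to\mathbb R^k$ and sets $X\subset\mathbb R^m$, $T\subset\mathbb R^k$, we say that the restriction $p_|:p^{-1}(T)\cap X\to T\cap p(X)$ is *the projection of a smooth locally trivial fibration* if each $t\in T\cap p(X)$ has an open neighbourhood $U$ in $\mathbb R^k$ such that there are a set $F$ and a diffeomorphism $p^{-1}(U)\cap X\cong U\times F$ commuting with the projections to $U$. (So the local trivializations over $T\cap p(X)$ come from trivializations over open subsets of $\mathbb R^k$.) **Proposition 2.4.** Let $f=(f_1,\dots,f_n):\mathbb R^m\to\mathbb R^n$ be a real analytic map with $1<n<m$ and $f(0)=0$. For $i=1,\dots,n$ let $\pi_i:\mathbb R^n\to\mathbb R$ be the $i$-th coordinate and $\pi_i^*:\mathbb R^n\to\mathbb R^{n-1}$ the projection forgetting the $i$-th coordinate; put $f_i^*=\pi_i^*\circ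 f$, and for $t\in\mathbb R^n$ put $t_i=\pi_i(t)$, $t_i^*=\pi_i^*(t)$. Let $\epsilon,\eta>0$ be real numbers and let $\Delta$ be the set of critical values of $f$ lying in $\mathbb B^n_\eta$. The following are equivalent: (i) The restriction $$f_|:f^{-1}(\mathbb B^n_\eta\setminus\Delta)\cap\mathbb B^m_\epsilon\to(\mathbb B^n_\eta\setminus\Delta)\cap f(\mathbb B^m_\epsilon)$$ is the projection of a smooth locally trivial fibration. (ii) For each $t\in(\mathbb B^n_\eta\setminus\Delta)\cap f(\mathbb B^m_\epsilon)$, each $x\in f^{-1}(t)\cap\mathbb S^{m-1}_\epsilon$ and each $i=1,\dots,n$: - (a) $T_x\big((f_i)^{-1}(t_i)\big)$ and $T_x(\mathbb S^{m-1}_\epsilon)$ are transverse, i.e. together span $\mathbb R^m$; - (b) $T_x\big((f_i^*)^{-1}(t_i^*)\big)$ and $T_x(\mathbb S^{m-1}_\epsilon)$ are transverse, i.e. together span $\mathbb R^m$; - (e) for every $s\in\pi_i^*(\mathbb B^n_\eta)$, with $H_s=(\pi_i^*)^{-1}(s)$, $I_s=\pi_i(\mathbb B^n_\eta\cap H_s)\setminus\pi_i(\Delta\cap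 H_s)$ and $X_s=(f_i^*)^{-1}(s)\cap\mathbb B^m_\epsilon$, the restriction $$(f_i)_|:(f_i)^{-1}(I_s)\cap X_s\to I_s\cap f_i(X_s)$$ is the projection of a smooth locally trivial fibration. (At the points $x$ in (ii) the maps $f_i$ and $f_i^*$ are submersions, and the tangent spaces of their fibres are the kernels of their derivatives.) -/

import Mathlib

open scoped ContDiff

namespace LeMilnor

section Smooth

variable {V W : Type*} [NormedAddCommGroup V] [NormedSpace ℝ V]
  [NormedAddCommGroup W] [NormedSpace ℝ W]

/-- A map is smooth on an arbitrary subset `A` of a normed space if near each point of `A` it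
coincides on `A` with a `C^∞` map that is defined on an open neighbourhood of the point. -/
def SmoothOnSet (g : V → W) (A : Set V) : Prop :=
  ∀ x ∈ A, ∃ O : Set V, IsOpen O ∧ x ∈ O ∧
    ∃ G : V → W, ContDiffOn ℝ ∞ G O ∧ Set.EqOn G g (A ∩ O)

/-- `φ` restricts to a diffeomorphism from the subset `A` onto the subset `B`. -/
def IsDiffeoBetween (φ : V → W) (A : Set V) (B : Set W) : Prop :=
  SmoothOnSet φ A ∧ Set.MapsTo φ A B ∧
    ∃ ψ : W → V, SmoothOnSet ψ B ∧ Set.MapsTo ψ B A ∧ Set.InvOn ψ φ A B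

/-- The restriction `p : p⁻¹(T) ∩ X → T ∩ p(X)` is the projection of a smooth locally trivial
fibration: every point of `T ∩ p(X)` has an open neighbourhood `U` in the target space over which
`p : p⁻¹(U) ∩ X → U` is smoothly trivial, that is, `p⁻¹(U) ∩ X` is diffeomorphic to a product
`U × F` by a diffeomorphism that commutes with the projections to `U`.

This is the fibration property in the sense of Ehresmann's lemma for manifolds with boundary: the
set `T` need not be open or a manifold, and the bundle over `T ∩ p(X)` is trivialized by
restrictions of smooth trivializations over open subsets of the target space. -/
def IsSmoothLocallyTrivialFibration (p : V → W) (X : Set V) (T : Set W) : Prop :=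
  ∀ t ∈ T ∩ p '' X, ∃ U : Set W, IsOpen U ∧ t ∈ U ∧
    ∃ (F : Set V) (φ : V → W × V),
      IsDiffeoBetween φ (p ⁻¹' U ∩ X) (U ×ˢ F) ∧ ∀ x ∈ p ⁻¹' U ∩ X, (φ x).1 = p x

/-- The tangent space at a regular point `x` of `g` to the fibre of `g` through `x`. -/
noncomputable def tangentFibre (g : V → W) (x : V) : Submodule ℝ V :=
  LinearMap.ker (fderiv ℝ g x : V →ₗ[ℝ] W)

/-- Two linear subspaces are transverse if together they span the whole space. -/
def TransverseSubspaces (P Q : Submodule ℝ V) : Prop := P ⊔ Q = ⊤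

/-- The critical points of `g`: the derivative is not surjective. -/
def criticalPoints (g : V → W) : Set V :=
  {x | ¬ Function.Surjective (fderiv ℝ g x)}

end Smooth

/-- The tangent space at `x ≠ 0` to the sphere around the origin that passes through `x`. -/
noncomputable def tangentSphere {m : ℕ} (x : EuclideanSpace ℝ (Fin m)) :
    Submodule ℝ (EuclideanSpace ℝ (Fin m)) :=
  (Submodule.span ℝ {x})ᗮ

section Projections

variable {n : ℕ}

/-- The coordinate projection `π_i : ℝⁿ → ℝ`. -/
def proj (i : Fin n) (t : EuclideanSpace ℝ (Fin n)) : ℝ := t i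

/-- The projection `π_i^* : ℝⁿ → ℝⁿ⁻¹` that forgets the `i`-th coordinate; `ℝⁿ⁻¹` has the
coordinates with index different from `i`. -/
def projStar (i : Fin n) (t : EuclideanSpace ℝ (Fin n)) :
    EuclideanSpace ℝ {j : Fin n // j ≠ i} :=
  WithLp.toLp 2 fun j => t j.1

/-- The line `H_s = (π_i^*)⁻¹(s)`. -/
def slice (i : Fin n) (s : EuclideanSpace ℝ {j : Fin n // j ≠ i}) :
    Set (EuclideanSpace ℝ (Fin n)) :=
  projStar i ⁻¹' {s}

end Projections

section Maps

variable {m n : ℕ}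

/-- The set of critical values of `f` in the closed ball of radius `η`. -/
def discriminant (f : EuclideanSpace ℝ (Fin m) → EuclideanSpace ℝ (Fin n)) (η : ℝ) :
    Set (EuclideanSpace ℝ (Fin n)) :=
  f '' criticalPoints f ∩ Metric.closedBall 0 η

/-- The coordinate function `f_i`. -/
def coord (f : EuclideanSpace ℝ (Fin m) → EuclideanSpace ℝ (Fin n)) (i : Fin n) :
    EuclideanSpace ℝ (Fin m) → ℝ :=
  proj i ∘ f

/-- The map `f_i^*` obtained from `f` by dropping the `i`-th coordinate function. -/
def coordStar (f : EuclideanSpace ℝ (Fin m) → EuclideanSpace ℝ (Fin n)) (i : Fin n) :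
    EuclideanSpace ℝ (Fin m) → EuclideanSpace ℝ {j : Fin n // j ≠ i} :=
  projStar i ∘ f

end Maps

end LeMilnor

namespace LeMilnor

open Set Filter Topology

/-! ### Ehresmann's lemma from a deformation of the identity, and lifting of curves -/

section General

variable {V W : Type*} [NormedAddCommGroup V] [NormedSpace ℝ V]
  [NormedAddCommGroup W] [NormedSpace ℝ W]

/-! Both conditions amount to the same infinitesimal fact: at every point `x` of the sphere lying
over a value in the ball of radius `η` outside the discriminant, `fderiv ℝ f x` maps the tangent
space of the sphere onto `ℝⁿ`.

A trivialization over an open set lifts each direction `w` to a two-sided curve in the ball through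
`x`. Its squared norm is maximal at `x`, so its velocity is tangent to the sphere, and `f` maps this
velocity to `w`. This gives the transversality conditions, while the slice fibrations are
restrictions of the trivialization to lines. Conversely, the same argument in the slice through `f
x` parallel to the `i`-th axis gives a tangent vector mapped to the `i`-th basis vector, and these
span.

From the infinitesimal fact, `exists_trivialization_closedBall` recovers the fibration. Instead of
flowing along vector fields, it moves points by Möbius transformations of the ball, which preserve
the ball and its boundary exactly. Moving along them in the directions given by an adjoint of the
derivative shifts the value of `f` in every direction, and the inverse function theorem along the
compact fibre turns this into a product structure. -/

theorem _root_.ContDiffOn.smoothOnSet {g : V → W} {O A : Set V} (hg : ContDiffOn ℝ ∞ g O)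
    (hO : IsOpen O) (hA : A ⊆ O) : SmoothOnSet g A :=
  fun _ hx => ⟨O, hO, hA hx, g, hg, fun _ _ => rfl⟩

/-- The inverse function theorem along a compact set: a smooth map that is injective on a compact
set and has injective derivative there is a diffeomorphism from a neighbourhood of this set onto an
open set. -/
theorem exists_openPartialHomeomorph_of_isCompact [FiniteDimensional ℝ V] [FiniteDimensional ℝ W]
    (hdim : Module.finrank ℝ V = Module.finrank ℝ W) {g : V → W} {O K : Set V} (hO : IsOpen O)
    (hg : ContDiffOn ℝ ∞ g O) (hK : IsCompact K) (hKO : K ⊆ O) (hinj : InjOn g K)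
    (hder : ∀ x ∈ K, Function.Injective (fderiv ℝ g x)) :
    ∃ e : OpenPartialHomeomorph V W, K ⊆ e.source ∧ e.source ⊆ O ∧ (∀ x ∈ e.source, e x = g x) ∧
      ContDiffOn ℝ ∞ e.symm e.target := by
  have : CompleteSpace V := FiniteDimensional.complete ℝ V
  have hgA : ∀ x ∈ O, ContDiffAt ℝ ∞ g x := fun x hx => hg.contDiffAt (hO.mem_nhds hx)
  have hequiv : ∀ x, Function.Injective (fderiv ℝ g x) → ∃ A : V ≃L[ℝ] W, (A : V →L[ℝ] W) =
      fderiv ℝ g x := fun x hx =>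
    ⟨(LinearEquiv.ofInjectiveOfFinrankEq (fderiv ℝ g x : V →ₗ[ℝ] W) hx hdim).toContinuousLinearEquiv,
      by ext v; rfl⟩
  have hloc : ∀ x ∈ O, Function.Injective (fderiv ℝ g x) → ∃ A : V ≃L[ℝ] W,
      HasStrictFDerivAt g (A : V →L[ℝ] W) x := by
    intro x hx hi
    obtain ⟨A, hA⟩ := hequiv x hi
    exact ⟨A, hA ▸ (hgA x hx).hasStrictFDerivAt (by simp)⟩
  obtain ⟨N, hN, hNinj⟩ := hinj.exists_mem_nhdsSet hK (fun x hx => (hgA x (hKO hx)).continuousAt)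
    (fun x hx => by
      obtain ⟨A, hA⟩ := hloc x (hKO hx) (hder x hx)
      exact ⟨_, (hA.toOpenPartialHomeomorph g).open_source.mem_nhds
        hA.mem_toOpenPartialHomeomorph_source, (hA.toOpenPartialHomeomorph g).injOn⟩)
  obtain ⟨N', hN'o, hKN', hN'N⟩ := mem_nhdsSet_iff_exists.1 hN
  -- Invertible operators form an open set, so the derivative stays invertible near `K`.
  set R : Set V := O ∩ fderiv ℝ g ⁻¹' range ((↑) : (V ≃L[ℝ] W) → V →L[ℝ] W)
  have hRo : IsOpen R :=
    (hg.continuousOn_fderiv_of_isOpen hO (by simp)).isOpen_inter_preimage hO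
      ContinuousLinearEquiv.isOpen
  have hW : IsOpen (N' ∩ R) := hN'o.inter hRo
  have hstrict : ∀ x ∈ N' ∩ R, ∃ A : V ≃L[ℝ] W, HasStrictFDerivAt g (A : V →L[ℝ] W) x := by
    rintro x ⟨-, hxO, A, hA⟩
    exact ⟨A, hA ▸ (hgA x hxO).hasStrictFDerivAt (by simp)⟩
  have hcont : ContinuousOn g (N' ∩ R) := hg.continuousOn.mono fun x hx => hx.2.1
  have hopen : IsOpenMap ((N' ∩ R).domRestrict g) := by
    rw [isOpenMap_iff_nhds_le]
    rintro ⟨x, hx⟩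
    obtain ⟨A, hA⟩ := hstrict x hx
    have h1 : map g (𝓝 x) = 𝓝 (g x) := hA.map_nhds_eq_of_equiv
    have h2 : map ((↑) : (N' ∩ R : Set V) → V) (𝓝 ⟨x, hx⟩) = 𝓝 x :=
      map_nhds_subtype_coe_eq_nhds hx (hW.mem_nhds hx)
    have h3 : (N' ∩ R).domRestrict g = g ∘ ((↑) : (N' ∩ R : Set V) → V) := rfl
    rw [h3, ← Filter.map_map, h2, h1]
    rfl
  have hinjW : InjOn g (N' ∩ R) := hNinj.mono fun x hx => hN'N hx.1
  let e := OpenPartialHomeomorph.ofContinuousOpenRestrict (hinjW.toPartialEquiv) hcont hopen hW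
  refine ⟨e, fun x hx => ⟨hKN' hx, hKO hx, ?_⟩, fun x hx => hx.2.1, fun x _ => rfl, ?_⟩
  · exact hequiv x (hder x hx)
  · intro y hy
    have hx := e.map_target hy
    obtain ⟨A, hA⟩ := hstrict _ hx
    refine (e.contDiffAt_symm hy (f₀' := A) hA.hasFDerivAt ?_).contDiffWithinAt
    exact hgA _ hx.2.1

/-- Ehresmann's lemma over a point, for a compact set `X` along which the identity can be deformed
by maps `y ↦ Ψ (y, c)` that preserve `X` and move the values of `f` in all directions. -/
theorem exists_trivialization_of_deformation [FiniteDimensional ℝ V] [FiniteDimensional ℝ W]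
    {f : V → W} (hf : ContDiff ℝ ∞ f) {X : Set V} (hX : IsCompact X) (t₀ : W)
    {Ψ : V × W → V} {O : Set (V × W)} (hO : IsOpen O) (hΨ : ContDiffOn ℝ ∞ Ψ O)
    (hO0 : ∀ y, (y, (0 : W)) ∈ O) (hΨ0 : ∀ y, Ψ (y, 0) = y)
    (hΨX : ∀ p ∈ O, p.1 ∈ X ↔ Ψ p ∈ X)
    (hder : ∀ y ∈ X, f y = t₀ → ∃ Z : W →L[ℝ] V, HasFDerivAt (fun c => Ψ (y, c)) Z 0 ∧
      Function.Injective (fderiv ℝ f y ∘L Z)) :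
    ∃ U : Set W, IsOpen U ∧ t₀ ∈ U ∧ ∃ (F : Set V) (φ : V → W × V),
      IsDiffeoBetween φ (f ⁻¹' U ∩ X) (U ×ˢ F) ∧ ∀ x ∈ f ⁻¹' U ∩ X, (φ x).1 = f x := by
  set F : Set V := X ∩ f ⁻¹' {t₀}
  have hFc : IsCompact F := hX.inter_right (isClosed_singleton.preimage hf.continuous)
  have hdΨ : ∀ y ∈ F, ∃ Z : W →L[ℝ] V, Function.Injective (fderiv ℝ f y ∘L Z) ∧
      HasFDerivAt Ψ ((ContinuousLinearMap.fst ℝ V W) + Z ∘L ContinuousLinearMap.snd ℝ V W)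
        (y, 0) := by
    rintro y ⟨hy, hyt⟩
    obtain ⟨Z, hZ, hZi⟩ := hder y hy hyt
    refine ⟨Z, hZi, ?_⟩
    have hd := ((hΨ.contDiffAt (hO.mem_nhds (hO0 y))).differentiableAt (by simp)).hasFDerivAt
    have h1 := HasFDerivAt.comp y hd (hasFDerivAt_prodMk_left (𝕜 := ℝ) y (0 : W))
    have h2 := HasFDerivAt.comp (0 : W) hd (hasFDerivAt_prodMk_right y (0 : W))
    have h1' : fderiv ℝ Ψ (y, 0) ∘L ContinuousLinearMap.inl ℝ V W = ContinuousLinearMap.id ℝ V :=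
      h1.unique ((hasFDerivAt_id y).congr_of_eventuallyEq (Eventually.of_forall hΨ0))
    have h2' : fderiv ℝ Ψ (y, 0) ∘L ContinuousLinearMap.inr ℝ V W = Z := h2.unique hZ
    refine hd.congr_fderiv (ContinuousLinearMap.ext fun p => ?_)
    have hp : p = ContinuousLinearMap.inl ℝ V W p.1 + ContinuousLinearMap.inr ℝ V W p.2 := by simp
    conv_lhs => rw [hp, map_add]
    exact congrArg₂ (· + ·) (DFunLike.congr_fun h1' p.1) (DFunLike.congr_fun h2' p.2)
  have hK : IsCompact (F ×ˢ ({0} : Set W)) := hFc.prod isCompact_singleton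
  have hKO : F ×ˢ ({0} : Set W) ⊆ O := by
    rintro ⟨y, c⟩ ⟨-, rfl⟩
    exact hO0 y
  have hfd : ∀ y, HasFDerivAt f (fderiv ℝ f y) y := fun y =>
    (hf.differentiable (by simp) y).hasFDerivAt
  -- Inverting `e₁` solves `f (Ψ (y, c)) = t` for `c`, given `t` and `y`. At `c = 0` the derivative
  -- is `(v, c) ↦ (df (v + Z c), v)`.
  obtain ⟨e₁, hKe₁, he₁O, he₁, hs₁⟩ := exists_openPartialHomeomorph_of_isCompact
    (g := fun p : V × W => (f (Ψ p), p.1)) (by simp [add_comm]) hO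
    ((hf.comp_contDiffOn hΨ).prodMk contDiffOn_fst) hK hKO
    (by
      rintro ⟨y, c⟩ ⟨-, rfl⟩ ⟨y', c'⟩ ⟨-, rfl⟩ h
      simpa using congrArg Prod.snd h)
    (by
      rintro ⟨y, c⟩ ⟨hy, rfl⟩
      obtain ⟨Z, hZi, hZ⟩ := hdΨ y hy
      have h := (HasFDerivAt.comp (y, (0 : W)) (by rw [hΨ0]; exact hfd y) hZ).prodMk
        (hasFDerivAt_fst (𝕜 := ℝ) (p := (y, (0 : W))))
      have h' := h.fderiv
      simp only [Function.comp_def] at h'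
      rw [h', injective_iff_map_eq_zero]
      rintro ⟨v, c⟩ hv
      obtain ⟨h1, h2⟩ := Prod.ext_iff.1 hv
      have hv0 : v = 0 := h2
      subst hv0
      have hc : c = 0 := (injective_iff_map_eq_zero _).1 hZi c (by simpa using h1)
      simp [hc])
  -- Inverting `e₂` at `(t₀, x)` finds `y` in the fibre over `t₀` and `c` with `Ψ (y, c) = x`.
  -- Keeping its source inside that of `e₁` lets the two inversions cancel.
  obtain ⟨e₂, hKe₂, he₂O, he₂, hs₂⟩ := exists_openPartialHomeomorph_of_isCompact
    (g := fun p : V × W => (f p.1, Ψ p)) (by simp [add_comm]) e₁.open_source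
    ((hf.comp_contDiffOn contDiffOn_fst).prodMk (hΨ.mono he₁O)) hK hKe₁
    (by
      rintro ⟨y, c⟩ ⟨-, rfl⟩ ⟨y', c'⟩ ⟨-, rfl⟩ h
      simpa [hΨ0] using congrArg Prod.snd h)
    (by
      rintro ⟨y, c⟩ ⟨hy, rfl⟩
      obtain ⟨Z, hZi, hZ⟩ := hdΨ y hy
      have h := (HasFDerivAt.comp (y, (0 : W)) (hfd y)
        (hasFDerivAt_fst (𝕜 := ℝ) (p := (y, (0 : W))))).prodMk hZ
      have h' := h.fderiv
      simp only [Function.comp_def] at h'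
      rw [h', injective_iff_map_eq_zero]
      rintro ⟨v, c⟩ hv
      obtain ⟨h1, h2⟩ := Prod.ext_iff.1 hv
      have h1' : fderiv ℝ f y v = 0 := h1
      have h2' : v + Z c = 0 := h2
      have hc : c = 0 := (injective_iff_map_eq_zero _).1 hZi c (by
        have := congrArg (fderiv ℝ f y) h2'
        simpa [h1'] using this)
      subst hc
      simpa using h2')
  have hT₁ : IsOpen (e₁ '' e₂.source) :=
    e₁.isOpen_image_of_subset_source e₂.open_source he₂O
  obtain ⟨U₁, V₁, hU₁, -, htU₁, hFV₁, hUV₁⟩ := generalized_tube_lemma isCompact_singleton hFc hT₁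
    (show ({t₀} : Set W) ×ˢ F ⊆ e₁ '' e₂.source by
      rintro ⟨t, y⟩ ⟨ht, hy⟩
      have hm : (y, (0 : W)) ∈ F ×ˢ ({0} : Set W) := ⟨hy, rfl⟩
      refine ⟨(y, 0), hKe₂ hm, ?_⟩
      rw [he₁ _ (hKe₁ hm)]
      simp only [hΨ0]
      exact Prod.ext (hy.2.trans ht.symm) rfl)
  have hS₂ : IsOpen {x : V | (t₀, x) ∈ e₂.target} :=
    e₂.open_target.preimage (Continuous.prodMk_right t₀)
  -- Points of `X` that `e₂` cannot move back to the fibre have compact image. Removing this image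
  -- from the base leaves only good points.
  have hC : IsClosed (f '' (X \ {x : V | (t₀, x) ∈ e₂.target})) :=
    ((hX.diff hS₂).image hf.continuous).isClosed
  have htC : t₀ ∉ f '' (X \ {x : V | (t₀, x) ∈ e₂.target}) := by
    rintro ⟨x, ⟨hx, hx'⟩, hxt⟩
    apply hx'
    have hm : (x, (0 : W)) ∈ e₂.source := hKe₂ ⟨⟨hx, hxt⟩, rfl⟩
    have := e₂.map_source hm
    rw [he₂ _ hm] at this
    simp only [hΨ0, hxt] at this
    exact this
  have hfib : ∀ x ∈ f ⁻¹' (U₁ ∩ (f '' (X \ {x : V | (t₀, x) ∈ e₂.target}))ᶜ) ∩ X,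
      (t₀, x) ∈ e₂.target := by
    rintro x ⟨⟨-, h⟩, hx⟩
    by_contra hx'
    exact h ⟨x, ⟨hx, hx'⟩, rfl⟩
  have hbase : ∀ p ∈ (U₁ ∩ (f '' (X \ {x : V | (t₀, x) ∈ e₂.target}))ᶜ) ×ˢ F,
      p ∈ e₁ '' e₂.source := fun p hp => hUV₁ ⟨hp.1.1, hFV₁ hp.2⟩
  have hsym₂ : ∀ x, (t₀, x) ∈ e₂.target → f (e₂.symm (t₀, x)).1 = t₀ ∧
      Ψ (e₂.symm (t₀, x)) = x := by
    intro x hx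
    have h := he₂ _ (e₂.map_target hx)
    rw [e₂.right_inv hx] at h
    obtain ⟨h1, h2⟩ := Prod.ext_iff.1 h
    exact ⟨h1.symm, h2.symm⟩
  -- The trivialization sends `x = Ψ (y, c)` to `(f x, y)`; its inverse sends `(t, y)` to `Ψ (y, c)`
  -- with `c` chosen so that the value of `f` is `t`.
  refine ⟨U₁ ∩ (f '' (X \ {x : V | (t₀, x) ∈ e₂.target}))ᶜ, hU₁.inter hC.isOpen_compl,
    ⟨htU₁ rfl, htC⟩, F, fun x => (f x, (e₂.symm (t₀, x)).1), ⟨?_, ?_, fun q => Ψ (e₁.symm q),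
      ?_, ?_, ?_, ?_⟩, fun _ _ => rfl⟩
  · refine ContDiffOn.smoothOnSet (O := {x : V | (t₀, x) ∈ e₂.target}) ?_ hS₂ hfib
    exact hf.contDiffOn.prodMk (contDiff_fst.comp_contDiffOn
      (hs₂.comp (contDiff_prodMk_right t₀).contDiffOn fun x hx => hx))
  · intro x hx
    have hx' := hfib x hx
    obtain ⟨h1, h2⟩ := hsym₂ x hx'
    refine ⟨hx.1, ?_, h1⟩
    rw [hΨX _ (he₁O (he₂O (e₂.map_target hx'))), h2]
    exact hx.2
  · refine ContDiffOn.smoothOnSet (O := e₁.target) ?_ e₁.open_target ?_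
    · exact hΨ.comp hs₁ fun q hq => he₁O (e₁.map_target hq)
    · intro q hq
      obtain ⟨p, hp, rfl⟩ := hbase q hq
      exact e₁.map_source (he₂O hp)
  · intro q hq
    obtain ⟨p, hp, rfl⟩ := hbase q hq
    simp only
    rw [e₁.left_inv (he₂O hp)]
    rw [he₁ _ (he₂O hp)] at hq
    exact ⟨hq.1, (hΨX _ (he₁O (he₂O hp))).1 hq.2.1⟩
  · intro x hx
    have hx' := hfib x hx
    obtain ⟨h1, h2⟩ := hsym₂ x hx'
    have hp := he₂O (e₂.map_target hx')
    have h3 := he₁ _ hp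
    rw [h2] at h3
    simp only
    rw [← h3, e₁.left_inv hp, h2]
  · intro q hq
    obtain ⟨p, hp, rfl⟩ := hbase q hq
    simp only
    rw [e₁.left_inv (he₂O hp)]
    have h1 := he₁ _ (he₂O hp)
    rw [h1] at hq ⊢
    have h2 := he₂ _ hp
    have h3 : f p.1 = t₀ := hq.2.2
    rw [h3] at h2
    rw [← h2, e₂.left_inv hp]

/-- Every direction in the base of a smooth locally trivial fibration lifts to a curve in the total
space through a given point. -/
theorem IsSmoothLocallyTrivialFibration.exists_lift {p : V → W} {X : Set V} {T : Set W}
    (h : IsSmoothLocallyTrivialFibration p X T) {x : V} (hx : x ∈ X) (hxT : p x ∈ T) (w : W) :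
    ∃ (γ : ℝ → V) (v : V), HasDerivAt γ v 0 ∧ γ 0 = x ∧
      ∀ᶠ s in 𝓝 (0 : ℝ), γ s ∈ X ∧ p (γ s) = p x + s • w := by
  obtain ⟨U, hU, hxU, F, φ, ⟨-, hφ, ψ, hψs, hψ, hl, hr⟩, hφp⟩ := h (p x) ⟨hxT, x, hx, rfl⟩
  have hxA : x ∈ p ⁻¹' U ∩ X := ⟨hxU, hx⟩
  have hφx : φ x = (p x, (φ x).2) := Prod.ext (hφp x hxA) rfl
  have hl0 : HasDerivAt (fun s : ℝ => ((p x + s • w, (φ x).2) : W × V)) (w, 0) 0 := by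
    refine HasDerivAt.prodMk ?_ (hasDerivAt_const _ _)
    simpa using ((hasDerivAt_id (0 : ℝ)).smul_const w).const_add (p x)
  have hU0 : ∀ᶠ s in 𝓝 (0 : ℝ), p x + s • w ∈ U := by
    have : ContinuousAt (fun s : ℝ => p x + s • w) 0 := by fun_prop
    exact this.eventually_mem (hU.mem_nhds (by simpa using hxU))
  have hmem : ∀ s : ℝ, p x + s • w ∈ U → ((p x + s • w, (φ x).2) : W × V) ∈ U ×ˢ F :=
    fun s hs => ⟨hs, (hφ hxA).2⟩
  -- `ψ` is smooth only on `U ×ˢ F`, so the curve is differentiated through a local smooth extension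
  -- `G`.
  obtain ⟨O, hO, hxO, G, hG, hGψ⟩ := hψs (φ x) (hφ hxA)
  have hO0 : ∀ᶠ s in 𝓝 (0 : ℝ), ((p x + s • w, (φ x).2) : W × V) ∈ O :=
    hl0.continuousAt.eventually_mem (hO.mem_nhds (by simpa [← hφx] using hxO))
  have hGd : HasFDerivAt G (fderiv ℝ G (φ x)) ((p x + (0 : ℝ) • w, (φ x).2) : W × V) := by
    rw [zero_smul, add_zero, ← hφx]
    exact ((hG.contDiffAt (hO.mem_nhds hxO)).differentiableAt (by simp)).hasFDerivAt
  refine ⟨fun s => ψ (p x + s • w, (φ x).2), fderiv ℝ G (φ x) (w, 0),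
    (hGd.comp_hasDerivAt (0 : ℝ) hl0).congr_of_eventuallyEq ?_, ?_, ?_⟩
  · filter_upwards [hU0, hO0] with s hs hs'
    exact (hGψ ⟨hmem s hs, hs'⟩).symm
  · simp only [zero_smul, add_zero]
    rw [← hφx]
    exact hl hxA
  · filter_upwards [hU0] with s hs
    have h1 := hψ (hmem s hs)
    refine ⟨h1.2, ?_⟩
    rw [← hφp _ h1, hr (hmem s hs)]

end General

/-! ### Möbius transformations of a ball -/

section Inner

variable {V W : Type*} [NormedAddCommGroup V] [InnerProductSpace ℝ V]
  [NormedAddCommGroup W] [InnerProductSpace ℝ W]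

/-- The denominator of a Möbius transformation of a ball. -/
noncomputable def moebiusDenom (y b : V) : ℝ := 1 + 2 * inner ℝ b y + ‖b‖ ^ 2 * ‖y‖ ^ 2

/-- The numerator of a Möbius transformation of the ball whose squared radius is `R`. -/
noncomputable def moebiusNum (R : ℝ) (y b : V) : V :=
  (R + 2 * R * inner ℝ b y + ‖y‖ ^ 2) • b + (1 - R * ‖b‖ ^ 2) • y

/-- The Möbius transformations `y ↦ moebius R y b` of the ball whose squared radius is `R`. -/
noncomputable def moebius (R : ℝ) (y b : V) : V := (moebiusDenom y b)⁻¹ • moebiusNum R y b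

/-- The factor multiplying `R - ‖y‖ ^ 2` is positive for small `b`, so inside, boundary and outside
of the ball are each preserved. -/
theorem sub_norm_moebius_sq (R : ℝ) {y b : V} (h : moebiusDenom y b ≠ 0) :
    R - ‖moebius R y b‖ ^ 2 = (1 - R * ‖b‖ ^ 2) * (R - ‖y‖ ^ 2) / moebiusDenom y b := by
  have h1 : ‖moebiusNum R y b‖ ^ 2 = R * moebiusDenom y b ^ 2 -
      (1 - R * ‖b‖ ^ 2) * (R - ‖y‖ ^ 2) * moebiusDenom y b := by
    rw [moebiusNum, norm_add_sq_real, norm_smul, norm_smul, mul_pow, mul_pow, Real.norm_eq_abs,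
      Real.norm_eq_abs, sq_abs, sq_abs, real_inner_smul_left, real_inner_smul_right, moebiusDenom]
    ring
  rw [moebius, norm_smul, mul_pow, h1, Real.norm_eq_abs, sq_abs]
  field_simp
  ring

theorem norm_moebius_le_iff {ε : ℝ} (hε : 0 ≤ ε) {y b : V} (h : 0 < moebiusDenom y b)
    (hb : ε ^ 2 * ‖b‖ ^ 2 < 1) : ‖moebius (ε ^ 2) y b‖ ≤ ε ↔ ‖y‖ ≤ ε := by
  have key := sub_norm_moebius_sq (ε ^ 2) h.ne'
  rw [mul_div_right_comm] at key
  have hpos : 0 < (1 - ε ^ 2 * ‖b‖ ^ 2) / moebiusDenom y b := div_pos (by linarith) h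
  rw [← sq_le_sq₀ (norm_nonneg _) hε, ← sub_nonneg, key, mul_nonneg_iff_of_pos_left hpos,
    sub_nonneg, sq_le_sq₀ (norm_nonneg _) hε]

theorem moebiusDenom_zero (y : V) : moebiusDenom y 0 = 1 := by simp [moebiusDenom]

theorem moebius_zero (R : ℝ) (y : V) : moebius R y 0 = y := by
  simp [moebius, moebiusDenom, moebiusNum]

theorem contDiff_moebiusDenom : ContDiff ℝ ∞ fun p : V × V => moebiusDenom p.1 p.2 := by
  unfold moebiusDenom
  exact (contDiff_const.add (contDiff_const.mul (contDiff_snd.inner ℝ contDiff_fst))).add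
    ((contDiff_snd.norm_sq ℝ).mul (contDiff_fst.norm_sq ℝ))

theorem contDiff_moebiusNum (R : ℝ) : ContDiff ℝ ∞ fun p : V × V => moebiusNum R p.1 p.2 := by
  unfold moebiusNum
  exact (((contDiff_const.add (contDiff_const.mul (contDiff_snd.inner ℝ contDiff_fst))).add
    (contDiff_fst.norm_sq ℝ)).smul contDiff_snd).add
    ((contDiff_const.sub (contDiff_const.mul (contDiff_snd.norm_sq ℝ))).smul contDiff_fst)

theorem contDiffOn_moebius (R : ℝ) : ContDiffOn ℝ ∞ (fun p : V × V => moebius R p.1 p.2)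
    {p | 0 < moebiusDenom p.1 p.2} :=
  (contDiff_moebiusDenom.contDiffOn.inv fun _ hp => ne_of_gt hp).smul
    (contDiff_moebiusNum R).contDiffOn

/-- The infinitesimal generators of the Möbius transformations of a ball. -/
noncomputable def moebiusField (R : ℝ) (y : V) : V →L[ℝ] V :=
  (R + ‖y‖ ^ 2) • ContinuousLinearMap.id ℝ V - (2 : ℝ) • (innerSL ℝ y).smulRight y

theorem moebiusField_apply (R : ℝ) (y b : V) :
    moebiusField R y b = (R + ‖y‖ ^ 2) • b - (2 : ℝ) • inner ℝ y b • y := rfl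

theorem contDiff_moebiusField (R : ℝ) : ContDiff ℝ ∞ (moebiusField R : V → V →L[ℝ] V) := by
  unfold moebiusField
  exact ((contDiff_const.add (contDiff_id.norm_sq ℝ)).smul contDiff_const).sub
    (((innerSL ℝ).contDiff.smulRight contDiff_id).const_smul (2 : ℝ))

theorem hasFDerivAt_moebius (R : ℝ) (y : V) :
    HasFDerivAt (fun b => moebius R y b) (moebiusField R y) 0 := by
  have hi : HasFDerivAt (fun b : V => inner ℝ b y) (innerSL ℝ y) 0 := by
    simp only [fun b : V => real_inner_comm y b]
    exact (innerSL ℝ y).hasFDerivAt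
  have hn : HasFDerivAt (fun b : V => ‖b‖ ^ 2) (0 : V →L[ℝ] ℝ) 0 := by
    simpa using (hasStrictFDerivAt_norm_sq (0 : V)).hasFDerivAt
  have hD : HasFDerivAt (fun b : V => moebiusDenom y b) ((2 : ℝ) • innerSL ℝ y) 0 :=
    (((hi.const_mul 2).const_add 1).add (hn.mul_const (‖y‖ ^ 2))).congr_fderiv (by simp)
  have hN : HasFDerivAt (fun b : V => moebiusNum R y b)
      ((R + ‖y‖ ^ 2) • ContinuousLinearMap.id ℝ V) 0 :=
    (((((hi.const_mul (2 * R)).const_add R).add_const (‖y‖ ^ 2)).smul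
      (hasFDerivAt_id (0 : V))).add (((hn.const_mul R).const_sub 1).smul_const y)).congr_fderiv
      (by ext v; simp)
  have hI := (hasDerivAt_inv (by simp [moebiusDenom_zero] : moebiusDenom y 0 ≠ 0)).comp_hasFDerivAt
    (0 : V) hD
  refine (hI.smul hN).congr_fderiv ?_
  ext v
  simp [moebiusField_apply, moebiusDenom_zero, moebiusNum, smul_smul, sub_eq_add_neg]

/-- By Cauchy–Schwarz, `⟪v, moebiusField R y v⟫ ≥ (R - ‖y‖ ^ 2) * ‖v‖ ^ 2`, so the field is
injective inside the ball. -/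
theorem moebiusField_surjective [FiniteDimensional ℝ V] {R : ℝ} {y : V} (h : ‖y‖ ^ 2 < R) :
    Function.Surjective (moebiusField R y) := by
  refine LinearMap.surjective_of_injective (f := (moebiusField R y : V →ₗ[ℝ] V)) ?_
  rw [injective_iff_map_eq_zero]
  intro v hv
  have hv' : inner ℝ v (moebiusField R y v) = 0 := by
    have hv2 : moebiusField R y v = 0 := hv
    rw [hv2, inner_zero_right]
  rw [moebiusField_apply, inner_sub_right, inner_smul_right, inner_smul_right, inner_smul_right,
    real_inner_self_eq_norm_sq, real_inner_comm v y] at hv'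
  have hcs : inner ℝ v y * inner ℝ v y ≤ ‖v‖ ^ 2 * ‖y‖ ^ 2 := by
    have := real_inner_mul_inner_self_le v y
    simpa [real_inner_self_eq_norm_sq] using this
  by_contra hne
  have hp : 0 < ‖v‖ ^ 2 := by positivity
  nlinarith [mul_pos hp (sub_pos.2 h)]

/-! ### Ehresmann's lemma for the closed ball -/

variable [FiniteDimensional ℝ V] [FiniteDimensional ℝ W]

theorem contDiff_adjoint :
    ContDiff ℝ ∞ (fun A : V →L[ℝ] W => ContinuousLinearMap.adjoint A) := by
  refine IsBoundedLinearMap.contDiff (IsLinearMap.with_bound ⟨fun A B => map_add _ A B, fun c A => ?_⟩ 1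
    fun A => ?_)
  · simp
  · simp

/-- `M M* c = 0` forces `M* c = 0`, and `M*` is injective when `M` is onto. -/
theorem injective_comp_adjoint {M : V →L[ℝ] W} (hM : Function.Surjective M) :
    Function.Injective (M ∘L ContinuousLinearMap.adjoint M) := by
  rw [injective_iff_map_eq_zero]
  intro c hc
  obtain ⟨v, rfl⟩ := hM c
  have h1 : ContinuousLinearMap.adjoint M (M v) = 0 := by
    rw [← inner_self_eq_zero (𝕜 := ℝ), ContinuousLinearMap.adjoint_inner_left]
    have : M (ContinuousLinearMap.adjoint M (M v)) = 0 := hc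
    rw [this, inner_zero_right]
  rw [← inner_self_eq_zero (𝕜 := ℝ), ← ContinuousLinearMap.adjoint_inner_right, h1,
    inner_zero_right]

/-- Ehresmann's lemma for a closed ball: `f` is smoothly trivial over a neighbourhood of a value
that is regular both for `f` on the ball and for the restriction of `f` to the sphere. -/
theorem exists_trivialization_closedBall {f : V → W} (hf : ContDiff ℝ ∞ f) {ε : ℝ} (hε : 0 < ε)
    (t₀ : W) (hreg : ∀ x, ‖x‖ ≤ ε → f x = t₀ → Function.Surjective (fderiv ℝ f x))
    (hsph : ∀ x, ‖x‖ = ε → f x = t₀ → ∀ w, ∃ v, inner ℝ x v = 0 ∧ fderiv ℝ f x v = w) :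
    ∃ U : Set W, IsOpen U ∧ t₀ ∈ U ∧ ∃ (F : Set V) (φ : V → W × V),
      IsDiffeoBetween φ (f ⁻¹' U ∩ Metric.closedBall 0 ε) (U ×ˢ F) ∧
        ∀ x ∈ f ⁻¹' U ∩ Metric.closedBall 0 ε, (φ x).1 = f x := by
  -- With `M = df ∘ moebiusField` and parameter `b = M* c`, the value of `f` moves at first order by
  -- `M M* c`. Unlike a chosen right inverse of `M`, the adjoint is defined and smooth in `y`
  -- everywhere.
  set A : V → W →L[ℝ] V := fun y =>
    ContinuousLinearMap.adjoint (fderiv ℝ f y ∘L moebiusField (ε ^ 2) y)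
  have hAs : ContDiff ℝ ∞ A := contDiff_adjoint.comp
    ((hf.fderiv_right (m := ∞) (by simp)).clm_comp (contDiff_moebiusField _))
  have hB : ContDiff ℝ ∞ fun p : V × W => (p.1, A p.1 p.2) :=
    contDiff_fst.prodMk ((hAs.comp contDiff_fst).clm_apply contDiff_snd)
  have hD : ContDiff ℝ ∞ fun p : V × W => moebiusDenom p.1 (A p.1 p.2) :=
    contDiff_moebiusDenom.comp hB
  refine exists_trivialization_of_deformation hf (isCompact_closedBall 0 ε) t₀
    (Ψ := fun p => moebius (ε ^ 2) p.1 (A p.1 p.2))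
    (O := {p | 0 < moebiusDenom p.1 (A p.1 p.2)} ∩ {p | ε ^ 2 * ‖A p.1 p.2‖ ^ 2 < 1})
    ?_ ?_ ?_ ?_ ?_ ?_
  · refine (isOpen_lt continuous_const hD.continuous).inter (isOpen_lt ?_ continuous_const)
    have : Continuous fun p : V × W => A p.1 p.2 := hB.continuous.snd
    fun_prop
  · exact (contDiffOn_moebius (ε ^ 2)).comp hB.contDiffOn fun p hp => hp.1
  · intro y
    simp [moebiusDenom_zero]
  · intro y
    simp [moebius_zero]
  · rintro p ⟨hp, hp'⟩
    rw [mem_closedBall_zero_iff, mem_closedBall_zero_iff]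
    exact (norm_moebius_le_iff hε.le hp hp').symm
  · intro y hy hyt
    rw [mem_closedBall_zero_iff] at hy
    refine ⟨moebiusField (ε ^ 2) y ∘L A y, ?_, ?_⟩
    · refine HasFDerivAt.comp (0 : W) (g := fun b => moebius (ε ^ 2) y b) ?_ (A y).hasFDerivAt
      rw [map_zero]
      exact hasFDerivAt_moebius _ y
    · have hM : Function.Surjective (fderiv ℝ f y ∘L moebiusField (ε ^ 2) y) := by
        rcases hy.lt_or_eq with hlt | heq
        · exact (hreg y hy hyt).comp (moebiusField_surjective (by gcongr))
        -- On the sphere the field is `2 ε²` times the orthogonal projection to the tangent space,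
        -- so surjectivity needs exactly `hsph`.
        · intro w
          obtain ⟨v, hv, hvw⟩ := hsph y heq hyt w
          refine ⟨(2 * ε ^ 2)⁻¹ • v, ?_⟩
          have h1 : moebiusField (ε ^ 2) y v = (2 * ε ^ 2) • v := by
            rw [moebiusField_apply, hv, heq]
            simp [two_mul]
          have h2 : (2 * ε ^ 2) ≠ 0 := by positivity
          rw [ContinuousLinearMap.comp_apply, map_smul, h1, inv_smul_smul₀ h2, hvw]
      exact injective_comp_adjoint hM

end Inner

/-! ### Lifted curves at the boundary sphere -/

section Boundary

variable {V W W' : Type*} [NormedAddCommGroup V] [InnerProductSpace ℝ V]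
  [NormedAddCommGroup W] [NormedSpace ℝ W] [NormedAddCommGroup W'] [NormedSpace ℝ W']

/-- Lifts of directions through boundary points of a ball are tangent to the sphere. -/
theorem inner_eq_zero_of_hasDerivAt {γ : ℝ → V} {x v : V} (hγ : HasDerivAt γ v 0) (h0 : γ 0 = x)
    (hball : ∀ᶠ s in 𝓝 (0 : ℝ), ‖γ s‖ ≤ ‖x‖) : inner ℝ x v = 0 := by
  have h := hγ.norm_sq
  have hmax : IsLocalMax (fun s => ‖γ s‖ ^ 2) 0 := by
    filter_upwards [hball] with s hs
    rw [h0]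
    gcongr
  have := hmax.hasDerivAt_eq_zero h
  rw [h0] at this
  linarith

/-- Directions that lift to curves in a subset of the ball through a boundary point are images of
vectors tangent to the sphere. -/
theorem exists_orthogonal_fderiv_eq {f : V → W} {x v : V} {w : W} (hf : DifferentiableAt ℝ f x)
    {γ : ℝ → V} (hγ : HasDerivAt γ v 0) (h0 : γ 0 = x)
    (h : ∀ᶠ s in 𝓝 (0 : ℝ), ‖γ s‖ ≤ ‖x‖ ∧ f (γ s) = f x + s • w) :
    inner ℝ x v = 0 ∧ fderiv ℝ f x v = w := by
  refine ⟨inner_eq_zero_of_hasDerivAt hγ h0 (h.mono fun _ hs => hs.1), ?_⟩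
  subst h0
  have h1 : HasDerivAt (f ∘ γ) (fderiv ℝ f (γ 0) v) 0 := hf.hasFDerivAt.comp_hasDerivAt 0 hγ
  have h2 : HasDerivAt (fun s : ℝ => f (γ 0) + s • w) w 0 := by
    simpa using ((hasDerivAt_id (0 : ℝ)).smul_const w).const_add (f (γ 0))
  exact h1.unique (h2.congr_of_eventuallyEq (h.mono fun _ hs => hs.2))

theorem IsSmoothLocallyTrivialFibration.exists_orthogonal {f : V → W} {T : Set W} {x : V} {ε : ℝ}
    (h : IsSmoothLocallyTrivialFibration f (Metric.closedBall 0 ε) T)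
    (hf : DifferentiableAt ℝ f x) (hx : ‖x‖ = ε) (hxT : f x ∈ T) (w : W) :
    ∃ v, inner ℝ x v = 0 ∧ fderiv ℝ f x v = w := by
  obtain ⟨γ, v, hγ, h0, hev⟩ := h.exists_lift (mem_closedBall_zero_iff.2 hx.le) hxT w
  refine ⟨v, exists_orthogonal_fderiv_eq hf hγ h0 (hev.mono fun s hs => ⟨?_, hs.2⟩)⟩
  rw [hx]
  exact mem_closedBall_zero_iff.1 hs.1

/-- Subtracting from `v` a tangent vector with the same image under the derivative of `f` leaves a
vector in the kernel of that derivative, hence in the kernel after composing with `L`. -/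
theorem transverseSubspaces_of_exists_orthogonal {f : V → W} {x : V} (hf : DifferentiableAt ℝ f x)
    (h : ∀ w, ∃ v, inner ℝ x v = 0 ∧ fderiv ℝ f x v = w) (L : W →L[ℝ] W') :
    TransverseSubspaces (tangentFibre (L ∘ f) x) (Submodule.span ℝ {x})ᗮ := by
  have hL : fderiv ℝ (L ∘ f) x = L ∘L fderiv ℝ f x :=
    (L.hasFDerivAt.comp x hf.hasFDerivAt).fderiv
  refine Submodule.eq_top_iff'.2 fun v => ?_
  obtain ⟨u, hu, huv⟩ := h (fderiv ℝ f x v)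
  refine Submodule.mem_sup.2 ⟨v - u, ?_, u, Submodule.mem_orthogonal_singleton_iff_inner_right.2 hu,
    sub_add_cancel v u⟩
  rw [tangentFibre, LinearMap.mem_ker, hL]
  simp [huv]

end Boundary

/-! ### Slices parallel to the coordinate axes -/

section Coordinates

variable {m n : ℕ}

theorem ext_proj {i : Fin n} {t t' : EuclideanSpace ℝ (Fin n)} (h : proj i t = proj i t')
    (h' : projStar i t = projStar i t') : t = t' := by
  ext j
  by_cases hj : j = i
  · subst hj
    exact h
  · exact congrArg (fun s : EuclideanSpace ℝ {j : Fin n // j ≠ i} => s ⟨j, hj⟩) h'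

/-- `π_i^*` as a continuous linear map. -/
noncomputable def projStarL (i : Fin n) :
    EuclideanSpace ℝ (Fin n) →L[ℝ] EuclideanSpace ℝ {j : Fin n // j ≠ i} :=
  LinearMap.toContinuousLinearMap
    { toFun := projStar i
      map_add' := fun _ _ => rfl
      map_smul' := fun _ _ => rfl }

/-- `proj i` is injective on each line `slice i s`, so no point of the line outside `Δ` shares its
coordinate with one in `Δ`. -/
theorem proj_mem_diff_iff {i : Fin n} {t : EuclideanSpace ℝ (Fin n)}
    {s : EuclideanSpace ℝ {j : Fin n // j ≠ i}} (ht : projStar i t = s)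
    (B Δ : Set (EuclideanSpace ℝ (Fin n))) :
    proj i t ∈ proj i '' (B ∩ slice i s) \ proj i '' (Δ ∩ slice i s) ↔ t ∈ B \ Δ := by
  have h : ∀ C : Set (EuclideanSpace ℝ (Fin n)), proj i t ∈ proj i '' (C ∩ slice i s) ↔ t ∈ C := by
    intro C
    constructor
    · rintro ⟨t', ⟨ht', hs⟩, hp⟩
      rwa [← ext_proj hp (Eq.trans hs ht.symm)]
    · exact fun hC => ⟨t, ⟨hC, ht⟩, rfl⟩
  rw [Set.mem_sdiff, Set.mem_sdiff, h, h]

/-- The restriction of a fibration over the lines parallel to the `i`-th axis. -/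
theorem IsSmoothLocallyTrivialFibration.coord_of_slice
    {f : EuclideanSpace ℝ (Fin m) → EuclideanSpace ℝ (Fin n)} {X : Set (EuclideanSpace ℝ (Fin m))}
    {B Δ : Set (EuclideanSpace ℝ (Fin n))} (h : IsSmoothLocallyTrivialFibration f X (B \ Δ))
    (hf : ContDiff ℝ ∞ f) (i : Fin n) (s : EuclideanSpace ℝ {j : Fin n // j ≠ i}) :
    IsSmoothLocallyTrivialFibration (coord f i) (coordStar f i ⁻¹' {s} ∩ X)
      (proj i '' (B ∩ slice i s) \ proj i '' (Δ ∩ slice i s)) := by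
  rintro _ ⟨ht, x, ⟨hxs, hxX⟩, rfl⟩
  obtain ⟨U, hU, hxU, F, φ, ⟨hφs, hφ, ψ, hψs, hψ, hl, hr⟩, hφp⟩ :=
    h (f x) ⟨(proj_mem_diff_iff hxs B Δ).1 ht, x, hxX, rfl⟩
  -- `ι` parametrizes the line through `f x` by the `i`-th coordinate; the trivialization is pulled
  -- back along it with the same fibre `F`.
  set ι : ℝ → EuclideanSpace ℝ (Fin n) := fun a =>
    f x + (a - proj i (f x)) • EuclideanSpace.single i (1 : ℝ) with hι
  have hιs : ContDiff ℝ ∞ ι := contDiff_const.add ((contDiff_id.sub contDiff_const).smul contDiff_const)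
  have hιp : ∀ a, proj i (ι a) = a := by
    intro a
    simp [hι, proj]
  have hιps : ∀ a, projStar i (ι a) = s := by
    intro a
    rw [← show projStar i (f x) = s from hxs]
    ext j
    simp [hι, projStar, j.2]
  have hιf : ∀ y, coordStar f i y = s → ι (coord f i y) = f y := fun y hy =>
    ext_proj (hιp _) ((hιps _).trans hy.symm)
  have hmaps : ∀ y ∈ coord f i ⁻¹' (ι ⁻¹' U) ∩ (coordStar f i ⁻¹' {s} ∩ X), y ∈ f ⁻¹' U ∩ X := by
    rintro y ⟨hyU, hys, hyX⟩
    refine ⟨?_, hyX⟩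
    have : ι (coord f i y) ∈ U := hyU
    rwa [hιf y hys] at this
  refine ⟨ι ⁻¹' U, hU.preimage hιs.continuous, ?_, F, fun y => (coord f i y, (φ y).2),
    ⟨?_, ?_, fun p => ψ (ι p.1, p.2), ?_, ?_, ?_, ?_⟩, fun _ _ => rfl⟩
  · rw [mem_preimage, hιf x hxs]
    exact hxU
  · intro y hy
    obtain ⟨O, hO, hyO, G, hG, hGφ⟩ := hφs y (hmaps y hy)
    refine ⟨O, hO, hyO, fun y => (coord f i y, (G y).2), ?_, fun z hz => ?_⟩
    · exact ((EuclideanSpace.proj (𝕜 := ℝ) i).contDiff.comp hf).contDiffOn.prodMk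
        (contDiff_snd.comp_contDiffOn hG)
    · simp only [hGφ ⟨hmaps z hz.1, hz.2⟩]
  · exact fun y hy => ⟨hy.1, (hφ (hmaps y hy)).2⟩
  · rintro ⟨a, y⟩ hp
    obtain ⟨O, hO, hyO, G, hG, hGψ⟩ := hψs (ι a, y) ⟨hp.1, hp.2⟩
    have hc : ContDiff ℝ ∞ fun p : ℝ × EuclideanSpace ℝ (Fin m) => (ι p.1, p.2) :=
      (hιs.comp contDiff_fst).prodMk contDiff_snd
    refine ⟨_, hO.preimage hc.continuous, hyO, _, hG.comp hc.contDiffOn fun p hp => hp,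
      fun p hp' => hGψ ⟨⟨hp'.1.1, hp'.1.2⟩, hp'.2⟩⟩
  · rintro ⟨a, y⟩ hp
    have hm : ((ι a, y) : _ × _) ∈ U ×ˢ F := ⟨hp.1, hp.2⟩
    have hfp : f (ψ (ι a, y)) = ι a := by rw [← hφp _ (hψ hm), hr hm]
    refine ⟨?_, ?_, (hψ hm).2⟩
    · simp only [mem_preimage, coord, Function.comp_apply, hfp, hιp]
      exact hp.1
    · simp only [mem_preimage, coordStar, Function.comp_apply, hfp, hιps]
      rfl
  · intro y hy
    have h1 : (φ y).1 = f y := hφp y (hmaps y hy)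
    simp only [hιf y hy.2.1]
    rw [← h1]
    exact hl (hmaps y hy)
  · rintro ⟨a, y⟩ hp
    have hm : ((ι a, y) : _ × _) ∈ U ×ˢ F := ⟨hp.1, hp.2⟩
    have hfp : f (ψ (ι a, y)) = ι a := by rw [← hφp _ (hψ hm), hr hm]
    simp only [coord, Function.comp_apply, hfp, hιp, hr hm]

/-- At a boundary point `x`, a fibration along the line through `f x` parallel to the `i`-th axis
gives a vector tangent to the sphere that `f` moves in the direction of this axis. -/
theorem exists_orthogonal_fderiv_eq_single
    {f : EuclideanSpace ℝ (Fin m) → EuclideanSpace ℝ (Fin n)} {x : EuclideanSpace ℝ (Fin m)}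
    (hf : DifferentiableAt ℝ f x) {i : Fin n} {I : Set ℝ}
    (h : IsSmoothLocallyTrivialFibration (coord f i)
      (coordStar f i ⁻¹' {projStar i (f x)} ∩ Metric.closedBall 0 ‖x‖) I) (hI : proj i (f x) ∈ I) :
    ∃ v, inner ℝ x v = 0 ∧ fderiv ℝ f x v = EuclideanSpace.single i (1 : ℝ) := by
  obtain ⟨γ, v, hγ, h0, hev⟩ := h.exists_lift (x := x) ⟨rfl, by simp⟩ hI 1
  refine ⟨v, exists_orthogonal_fderiv_eq hf hγ h0 (hev.mono fun s hs => ?_)⟩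
  obtain ⟨⟨hs1, hs2⟩, hs3⟩ := hs
  refine ⟨mem_closedBall_zero_iff.1 hs2, ext_proj (i := i) ?_ ?_⟩
  · refine Eq.trans hs3 ?_
    simp [coord, proj]
  · refine Eq.trans hs1 ?_
    ext j
    simp [projStar, j.2]

end Coordinates

end LeMilnor

/-! ### The equivalence -/

theorem proposition2p4 (m n : ℕ) (hn : 1 < n) (hnm : n < m)
    (f : EuclideanSpace ℝ (Fin m) → EuclideanSpace ℝ (Fin n))
    (hf : AnalyticOnNhd ℝ f Set.univ) (hf0 : f 0 = 0)
    (ε η : ℝ) (hε : 0 < ε) (hη : 0 < η) :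
    LeMilnor.IsSmoothLocallyTrivialFibration f (Metric.closedBall 0 ε)
        (Metric.closedBall 0 η \ LeMilnor.discriminant f η) ↔
      ∀ t ∈ (Metric.closedBall 0 η \ LeMilnor.discriminant f η) ∩ f '' Metric.closedBall 0 ε,
        ∀ x ∈ f ⁻¹' {t} ∩ Metric.sphere 0 ε, ∀ i : Fin n,
          LeMilnor.TransverseSubspaces
              (LeMilnor.tangentFibre (LeMilnor.coord f i) x) (LeMilnor.tangentSphere x) ∧
          LeMilnor.TransverseSubspaces
              (LeMilnor.tangentFibre (LeMilnor.coordStar f i) x) (LeMilnor.tangentSphere x) ∧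
          ∀ s ∈ LeMilnor.projStar i '' Metric.closedBall 0 η,
            LeMilnor.IsSmoothLocallyTrivialFibration (LeMilnor.coord f i)
              (LeMilnor.coordStar f i ⁻¹' {s} ∩ Metric.closedBall 0 ε)
              (LeMilnor.proj i '' (Metric.closedBall 0 η ∩ LeMilnor.slice i s) \
                LeMilnor.proj i '' (LeMilnor.discriminant f η ∩ LeMilnor.slice i s)) := by
  have hfs : ContDiff ℝ ∞ f := contDiffOn_univ.1 (hf.contDiffOn uniqueDiffOn_univ)
  have hfd : ∀ x, DifferentiableAt ℝ f x := hfs.differentiable (by simp)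
  constructor
  · rintro h t ⟨ht, -⟩ x ⟨rfl, hx⟩ i
    have hort := h.exists_orthogonal (hfd x) (mem_sphere_zero_iff_norm.1 hx) ht
    exact ⟨LeMilnor.transverseSubspaces_of_exists_orthogonal (hfd x) hort
        (EuclideanSpace.proj (𝕜 := ℝ) i),
      LeMilnor.transverseSubspaces_of_exists_orthogonal (hfd x) hort (LeMilnor.projStarL i),
      fun s _ => h.coord_of_slice hfs i s⟩
  · intro h t ht
    refine LeMilnor.exists_trivialization_closedBall hfs hε t ?_ ?_
    · intro x _ hxt
      by_contra hx
      exact ht.1.2 ⟨⟨x, hx, hxt⟩, ht.1.1⟩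
    · rintro x rfl rfl w
      -- The slice used is the one through `f x` itself; `f x` avoids the discriminant, so its
      -- `i`-th coordinate lies in the base of the slice fibration.
      have hbasis : ∀ i : Fin n, ∃ v, inner ℝ x v = 0 ∧
          fderiv ℝ f x v = EuclideanSpace.single i (1 : ℝ) := fun i =>
        LeMilnor.exists_orthogonal_fderiv_eq_single (hfd x)
          ((h (f x) ht x ⟨rfl, by simp⟩ i).2.2 _ ⟨f x, ht.1.1, rfl⟩)
          ((LeMilnor.proj_mem_diff_iff rfl _ _).2 ht.1)
      choose v hv hfv using hbasis
      refine ⟨∑ i, w i • v i, ?_, ?_⟩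
      · simp [inner_sum, inner_smul_right, hv]
      · simp only [map_sum, map_smul, hfv]
        ext j
        simp [Finset.sum_apply, Pi.single_apply]
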